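/- Let $g:[0,1]\to\mathbb R$ and $x^*\in[0,1]$ be such that $g(x)>0$ for $x<x^*$ and $g(x)<0$ for $x>x^*$ (nothing is assumed about $g(x^*)$). An evaluation of $g$ at $x\in[0,1]$ returns $Y(x)=g(x)+\epsilon(x)$, where the law of the noise $\epsilon(x)$ may depend on $x$ and the noises of different evaluations are independent. Put $\tilde Z(x)=1$ if $Y(x)\ge 0$ and $\tilde Z(x)=-1$ otherwise, and let $\tilde p(x)=P(\tilde Z(x)=1)$ for $x\le x^*$ and $\tilde p(x)=P(\tilde Z(x)=-1)$ for $x>x^*$. Fix $\gamma\in(0,1)$ and a test of power one with confidence parameter $\gamma$, that is, positive numbers $(k_m)_{m\ge1}$ such that for the random walk $S_m$ ($S_0=0$) with i.i.d. increments in $\{-1,1\}$ and drift $\theta\in[-1,1]$ the time $\inf\{m\ge1:|S_m|\ge k_m\}$ is finite with probability at most $\gamma$ if $\theta=0$ and with probability $1$ if $\theta\ne0$. Fix $p\in(1/2,\,1-\gamma/2)$ and a probability density $f_0$ on $[0,1]$ that is positive everywhere. The probabilistic bisection algorithm does the following for $n=0,1,2,\dots$: let $X_n$ be the median of $f_n$;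 evaluate $g$ repeatedly at $X_n$, with observed signs $\tilde Z_{n,1},\tilde Z_{n,2},\dots$ and $S_{n,m}=\sum_{i=1}^m\tilde Z_{n,i}$, up to $N_n=\inf\{m\ge1:|S_{n,m}|\ge k_m\}$; put $Z_n=1$ if $S_{n,N_n}>0$ and $Z_n=-1$ if $S_{n,N_n}<0$; if $Z_n=1$, let $f_{n+1}(y)=2pf_n(y)$ for $y\ge X_n$ and $f_{n+1}(y)=2(1-p)f_n(y)$ for $y<X_n$; if $Z_n=-1$, let $f_{n+1}(y)=2(1-p)f_n(y)$ for $y\ge X_n$ and $f_{n+1}(y)=2pf_n(y)$ for $y<X_n$. Let $T_n=\sum_{i=0}^nN_i$ be the total number of evaluations up to the end of step $n$. Suppose that $\tilde p(x)>1/2$ for all $x\ne x^*$, that almost surely $X_n\ne x^*$ for all $n$, and that there exist $\delta,c>0$ such that $0\le\tilde p(x)-1/2\le c|x-x^*|$ for all $x\in[0,1]\cap(x^*-\delta,x^*+\delta)$. Then almost surely $T_n<\infty$ for all $n$, and the sequence $(T_n^{1/2}|X_n-x^*|:n\ge0)$ of random variables is not tight. -/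

import Mathlib

open MeasureTheory ProbabilityTheory unitInterval
open scoped ENNReal

noncomputable section

namespace PBA

/-! ### Tests of power one -/

/-- The partial sum `S_m = z_1 + ⋯ + z_m` of a sequence of increments; the increment `z_{i+1}` is
stored as `z i`. -/
def walk (z : ℕ → ℝ) (m : ℕ) : ℝ := ∑ i ∈ Finset.range m, z i

/-- The first `m ≥ 1` with `|S_m| ≥ k m`, and `⊤` if there is none. -/
def testTime (k : ℕ → ℝ) (z : ℕ → ℝ) : ℕ∞ :=
  ⨅ (m : ℕ) (_ : 1 ≤ m ∧ k m ≤ |walk z m|), (m : ℕ∞)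

/-- The decision of the test: `+1` if the walk is positive when the test stops, `-1` if it is
negative. (If the test never stops, no decision is made; the value is then irrelevant.) -/
def testSignal (k : ℕ → ℝ) (z : ℕ → ℝ) : ℝ :=
  if 0 < walk z (testTime k z).toNat then 1 else -1

/-- The law of a sequence of i.i.d. increments equal to `1` with probability `u` and to `-1` with
probability `1 - u`, so that the walk has drift `2 u - 1`. -/
def incrementLaw (u : I) : Measure (ℕ → ℝ) :=
  Measure.infinitePi fun _ : ℕ => bernoulliMeasure (1 : ℝ) (-1) u

/-- The boundary `k` gives a test of power one with confidence parameter `γ`: it is positive, the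
test stops with probability at most `γ` if the drift is zero, and almost surely otherwise. -/
structure IsPowerOneTest (k : ℕ → ℝ) (γ : ℝ) : Prop where
  pos : ∀ m : ℕ, 1 ≤ m → 0 < k m
  level : ∀ u : I, 2 * (u : ℝ) - 1 = 0 →
    incrementLaw u {z | testTime k z < ⊤} ≤ ENNReal.ofReal γ
  power : ∀ u : I, 2 * (u : ℝ) - 1 ≠ 0 → incrementLaw u {z | testTime k z < ⊤} = 1

/-! ### Densities on `[0, 1]`, their medians and the update -/

/-- `f` is a probability density on `[0, 1]` that is positive everywhere. -/
structure IsPositiveDensity (f : I → ℝ) : Prop where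
  measurable : Measurable f
  pos : ∀ y, 0 < f y
  integral_eq_one : ∫ y, f y = 1

/-- The median `F⁻¹(1/2)` of a density `f` on `[0, 1]`. -/
def median (f : I → ℝ) : I := sInf {x : I | 1 / 2 ≤ ∫ y in Set.Iic x, f y}

open Classical in
/-- The update of the density `f` with the signal `Z` at the point `x`. -/
def update (p : ℝ) (f : I → ℝ) (x : I) (Z : ℝ) : I → ℝ := fun y =>
  if Z = 1 then (if x ≤ y then 2 * p * f y else 2 * (1 - p) * f y)
  else (if x ≤ y then 2 * (1 - p) * f y else 2 * p * f y)

/-! ### The algorithm, run on a given realization `e` of the noise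

`e n i x` is the noise in the `(i + 1)`-st evaluation at the point `x` in macro replication `n`. -/

/-- The sign of an observation: `+1` if it is nonnegative, `-1` otherwise. -/
def obsSign (y : ℝ) : ℝ := if 0 ≤ y then 1 else -1

/-- The signs observed when `g` is evaluated repeatedly at `x` with noise `e 0 x, e 1 x, …`. -/
def obsSigns (g : I → ℝ) (e : ℕ → I → ℝ) (x : I) : ℕ → ℝ := fun i => obsSign (g x + e i x)

/-- The density `f_n`. -/
def density (g : I → ℝ) (k : ℕ → ℝ) (p : ℝ) (f₀ : I → ℝ) (e : ℕ → ℕ → I → ℝ) : ℕ → I → ℝ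
  | 0 => f₀
  | n + 1 =>
    let f := density g k p f₀ e n
    update p f (median f) (testSignal k (obsSigns g (e n) (median f)))

/-- The measurement point `X_n`, the median of `f_n`. -/
def point (g : I → ℝ) (k : ℕ → ℝ) (p : ℝ) (f₀ : I → ℝ) (e : ℕ → ℕ → I → ℝ) (n : ℕ) : I :=
  median (density g k p f₀ e n)

/-- The number `N_n` of evaluations made by the test of power one at `X_n`. -/
def runlength (g : I → ℝ) (k : ℕ → ℝ) (p : ℝ) (f₀ : I → ℝ) (e : ℕ → ℕ → I → ℝ) (n : ℕ) : ℕ∞ :=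
  testTime k (obsSigns g (e n) (point g k p f₀ e n))

/-- The wall-clock time `T_n = N_0 + ⋯ + N_n`. -/
def wallClock (g : I → ℝ) (k : ℕ → ℝ) (p : ℝ) (f₀ : I → ℝ) (e : ℕ → ℕ → I → ℝ) (n : ℕ) : ℕ∞ :=
  ∑ i ∈ Finset.range (n + 1), runlength g k p f₀ e i

/-- `T_n ^ (1/2) * |X_n - x*|`. -/
def scaledError (g : I → ℝ) (k : ℕ → ℝ) (p : ℝ) (f₀ : I → ℝ) (xs : I) (e : ℕ → ℕ → I → ℝ)
    (n : ℕ) : ℝ :=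
  Real.sqrt ((wallClock g k p f₀ e n).toNat : ℝ) * |(point g k p f₀ e n : ℝ) - xs|

/-! ### Standing assumptions -/

/-- `xs` is the root of `g`, with no condition on the value `g xs`. -/
def IsRoot (g : I → ℝ) (xs : I) : Prop :=
  (∀ x, x < xs → 0 < g x) ∧ (∀ x, xs < x → g x < 0)

open Classical in
/-- The probability `p̃(x)` that the sign of one observation `g x + ε`, with `ε` of law `ν x`,
indicates the direction of the root `xs` from `x`. -/
def correctProb (g : I → ℝ) (ν : I → Measure ℝ) (xs x : I) : ℝ :=
  if x ≤ xs then (ν x).real {t | obsSign (g x + t) = 1}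
  else (ν x).real {t | obsSign (g x + t) = -1}

/-- The observation noise: `ε n i x` has law `ν x`, and evaluations are independent of each other.
Only one point `x` is used in each evaluation `(n, i)`, so that nothing is
required of the dependence between `ε n i x` and `ε n i x'`. -/
structure IsNoise {Ω : Type*} [MeasurableSpace Ω] (P : Measure Ω) (ν : I → Measure ℝ)
    (ε : ℕ → ℕ → I → Ω → ℝ) : Prop where
  measurable : ∀ n i x, Measurable (ε n i x)
  law : ∀ n i x, P.map (ε n i x) = ν x
  indep : iIndepFun (fun (q : ℕ × ℕ) (ω : Ω) (x : I) => ε q.1 q.2 x ω) P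

end PBA

end

noncomputable section

namespace PBA

/-! Near the root a single sign is almost fair, and a test of power one is too slow there for the
rate `1/2`. Write `d = |X_n - x*|` and let `θ` be the drift of the signs at `X_n`, so that `|θ| ≤ 2
c d` near `x*`. If the scaled errors were tight, then for some `R` the bound `T_n ^ (1/2) * d ≤ R`
would hold with probability close to one for all `n`. Since `T_n ≥ n + 1`, this forces `d` to be
small for large `n`; since `N_n ≤ T_n`, it forces `N_n ≤ (R / d) ^ 2`, hence `N_n θ ^ 2 ≤ K` with `K
= 4 c ^ 2 R ^ 2`.

This contradicts `exists_incrementLaw_testTime_le`: for small drift, `N θ ^ 2 ≤ K` has probability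
at most `q < 1`, where `q` does not depend on `K`. Under zero drift, infinitely many boundary
crossings form an exchangeable event of probability at most `γ < 1`, hence a null event by
Hewitt–Savage, so crossings after a late time `M` are as unlikely as desired. Cauchy–Schwarz for the
likelihood ratio, whose second moment is `(1 + θ ^ 2) ^ n ≤ exp (n θ ^ 2)`, carries this over to
drift `θ` up to time `K / θ ^ 2`. Crossings before `M` have probability about `√γ` at most when `θ`
is small.

The bound passes from fixed points to the random point `X_n` by `measure_point_mem_inter_le`,
because `X_n` depends on earlier noise only. Finiteness of `T_n` follows in the same way from the
power of the test. -/

/-! ### The Hewitt–Savage zero-one law -/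

/-- The permutation of `ℕ` that exchanges the blocks `[0, N)` and `[N, 2 N)`. -/
def blockSwap (N : ℕ) : Equiv.Perm ℕ :=
  Function.Involutive.toPerm
    (fun i => if i < N then i + N else if i < 2 * N then i - N else i) (by
      intro i
      dsimp only
      split_ifs <;> omega)

lemma blockSwap_apply (N i : ℕ) :
    blockSwap N i = if i < N then i + N else if i < 2 * N then i - N else i := rfl

lemma blockSwap_of_lt {N i : ℕ} (h : i < N) : blockSwap N i = i + N := by
  simp [blockSwap_apply, h]

lemma finite_blockSwap_ne (N : ℕ) : {i | blockSwap N i ≠ i}.Finite := by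
  refine (Set.finite_Iio (2 * N)).subset fun i hi => ?_
  by_contra h
  simp only [Set.mem_Iio, not_lt] at h
  refine hi ?_
  have h1 : ¬ i < N := by omega
  have h2 : ¬ i < 2 * N := by omega
  simp [blockSwap_apply, h1, h2]

/-- The **Hewitt–Savage zero-one law**. -/
theorem measure_eq_zero_or_one_of_exchangeable {α : Type*} [MeasurableSpace α] (ρ : Measure α)
    [IsProbabilityMeasure ρ] {A : Set (ℕ → α)} (hA : MeasurableSet A)
    (hinv : ∀ π : Equiv.Perm ℕ, {i | π i ≠ i}.Finite → (fun z i => z (π i)) ⁻¹' A = A) :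
    Measure.infinitePi (fun _ : ℕ => ρ) A = 0 ∨ Measure.infinitePi (fun _ : ℕ => ρ) A = 1 := by
  set P := Measure.infinitePi (fun _ : ℕ => ρ) with hP
  -- Up to `ε`, `A` is a cylinder `B`; by invariance it is also, up to `ε`, the shifted copy `C` of
  -- `B`, which is independent of `B`. Hence `P A` is close to both `P B` and `P (B ∩ C) = P B ^ 2`,
  -- which forces `P A = P A ^ 2`.
  have key : ∀ ε : ℝ, 0 < ε → |P.real A - P.real A ^ 2| ≤ 4 * ε := by
    intro ε hε
    obtain ⟨B, hB, hAB⟩ := (Measure.MeasureDense.of_generateFrom_isSetAlgebra_finite (μ := P)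
      isSetAlgebra_measurableCylinders generateFrom_measurableCylinders.symm).approx A hA
      (measure_ne_top _ _) ε hε
    obtain ⟨s, S, hS, rfl⟩ := (mem_measurableCylinders _).1 hB
    obtain ⟨N, hN⟩ := s.exists_nat_subset_range
    set π := blockSwap N
    have hmp : MeasurePreserving (fun (z : ℕ → α) i => z (π i)) P P :=
      ⟨by fun_prop, Measure.map_infinitePi_infinitePi_of_inj (P := fun _ : ℕ => ρ) π.injective⟩
    set B : Set (ℕ → α) := cylinder s S
    have hBm : MeasurableSet B := MeasurableSet.cylinder s hS
    set C := (fun (z : ℕ → α) i => z (π i)) ⁻¹' B with hC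
    have hCm : MeasurableSet C := hmp.measurable hBm
    have hPC : P.real C = P.real B := by
      simp only [measureReal_def, hC, hmp.measure_preimage hBm.nullMeasurableSet]
    have hd : P.real (symmDiff A B) ≤ ε :=
      ENNReal.toReal_le_of_le_ofReal hε.le hAB.le
    have hd' : P.real (symmDiff A C) ≤ ε := by
      have h1 : symmDiff A C = (fun (z : ℕ → α) i => z (π i)) ⁻¹' (symmDiff A B) := by
        rw [Set.preimage_symmDiff, hinv π (finite_blockSwap_ne N)]
      have h2 : P.real (symmDiff A C) = P.real (symmDiff A B) := by
        rw [h1, measureReal_def, hmp.measure_preimage (hA.symmDiff hBm).nullMeasurableSet,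
          measureReal_def]
      exact h2 ▸ hd
    have hBC : P.real (B ∩ C) = P.real B ^ 2 := by
      -- `B` reads coordinates below `N` and `C` reads their images, which are at least `N`.
      have hind := (iIndepFun_infinitePi (P := fun _ : ℕ => ρ) (X := fun _ x => x)
        (fun _ => measurable_id)).indepFun_finset s (s.map π.toEmbedding) (by
          rw [Finset.disjoint_left]
          intro i hi hi'
          obtain ⟨j, hj, rfl⟩ := Finset.mem_map.1 hi'
          have h1 := Finset.mem_range.1 (hN hi)
          have h2 := blockSwap_of_lt (Finset.mem_range.1 (hN hj))
          simp only [Equiv.coe_toEmbedding, π] at h1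
          omega) (fun i => measurable_pi_apply i)
      let r : ((i : s.map π.toEmbedding) → α) → (s → α) := fun w i =>
        w ⟨π i, Finset.mem_map_of_mem π.toEmbedding i.2⟩
      have hr : Measurable r := by fun_prop
      have := hind.measure_inter_preimage_eq_mul S (r ⁻¹' S) hS (hr hS)
      have h3 : P (B ∩ C) = P B * P C := this
      rw [measureReal_def, h3, ENNReal.toReal_mul, ← measureReal_def, ← measureReal_def, hPC, sq]
    have h1 : |P.real A - P.real B| ≤ ε :=
      (abs_measureReal_sub_le_measureReal_symmDiff hA.nullMeasurableSet hBm.nullMeasurableSet).trans hd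
    have h2 : |P.real A - P.real B ^ 2| ≤ 2 * ε := by
      rw [← hBC]
      refine (abs_measureReal_sub_le_measureReal_symmDiff hA.nullMeasurableSet
        (hBm.inter hCm).nullMeasurableSet).trans ?_
      have : symmDiff A (B ∩ C) ⊆ symmDiff A B ∪ symmDiff A C := by
        intro z
        simp only [Set.mem_symmDiff, Set.mem_inter_iff, Set.mem_union]
        tauto
      calc P.real (symmDiff A (B ∩ C)) ≤ P.real (symmDiff A B ∪ symmDiff A C) :=
            measureReal_mono this
        _ ≤ P.real (symmDiff A B) + P.real (symmDiff A C) := measureReal_union_le _ _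
        _ ≤ 2 * ε := by linarith
    have ha0 : 0 ≤ P.real A := measureReal_nonneg
    have hb0 : 0 ≤ P.real B := measureReal_nonneg
    have ha1 : P.real A ≤ 1 := measureReal_le_one
    have hb1 : P.real B ≤ 1 := measureReal_le_one
    have h3 : |P.real B ^ 2 - P.real A ^ 2| ≤ 2 * ε := by
      have : P.real B ^ 2 - P.real A ^ 2 = (P.real B + P.real A) * (P.real B - P.real A) := by ring
      rw [this, abs_mul, abs_of_nonneg (by positivity), abs_sub_comm]
      nlinarith [abs_nonneg (P.real A - P.real B)]
    calc |P.real A - P.real A ^ 2|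
        ≤ |P.real A - P.real B ^ 2| + |P.real B ^ 2 - P.real A ^ 2| := abs_sub_le _ _ _
      _ ≤ 4 * ε := by linarith
  have h0 : P.real A - P.real A ^ 2 = 0 := by
    by_contra hne
    have := key (|P.real A - P.real A ^ 2| / 8) (by positivity)
    have h' : 0 < |P.real A - P.real A ^ 2| := by positivity
    linarith
  have h1 : P.real A * (1 - P.real A) = 0 := by linarith
  rcases mul_eq_zero.1 h1 with h | h
  · exact Or.inl ((measureReal_eq_zero_iff).1 h)
  · right
    have : P.real A = 1 := by linarith
    rwa [measureReal_def, ENNReal.toReal_eq_one_iff] at this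

/-! ### Change of measure for Bernoulli increments -/

instance (u : I) : IsProbabilityMeasure (incrementLaw u) := by
  unfold incrementLaw; infer_instance

/-- The fair probability `1 / 2`, which gives drift zero. -/
def half : I := ⟨1 / 2, by norm_num, by norm_num⟩

/-- The likelihood ratio of one increment with drift `2 u - 1` to one with drift zero. -/
def likelihood (u : I) (t : ℝ) : ℝ≥0∞ := ENNReal.ofReal (1 + (2 * (u : ℝ) - 1) * t)

@[fun_prop]
lemma measurable_likelihood (u : I) : Measurable (likelihood u) := by
  unfold likelihood; fun_prop

lemma lintegral_bernoulliMeasure (u : I) (f : ℝ → ℝ≥0∞) :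
    ∫⁻ t, f t ∂(bernoulliMeasure (1 : ℝ) (-1) u)
      = ENNReal.ofReal u * f 1 + ENNReal.ofReal (1 - u) * f (-1) := by
  have h1 : ((toNNReal u : NNReal) : ℝ≥0∞) = ENNReal.ofReal u := by
    rw [ENNReal.ofReal]; congr 1; ext; simp [u.2.1]
  have h2 : ((toNNReal (σ u) : NNReal) : ℝ≥0∞) = ENNReal.ofReal (1 - u) := by
    rw [ENNReal.ofReal]; congr 1; ext; simp [u.2.2]
  rw [bernoulliMeasure_def, lintegral_add_measure, lintegral_smul_measure, lintegral_smul_measure,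
    lintegral_dirac, lintegral_dirac, ← h1, ← h2]
  rfl

/-- With `θ = 2 u - 1`, the reweighted masses `(1 + θ) / 2` and `(1 - θ) / 2` are `u` and `1 - u`.
-/
lemma lintegral_half_mul_likelihood (u : I) (f : ℝ → ℝ≥0∞) :
    ∫⁻ t, f t * likelihood u t ∂(bernoulliMeasure (1 : ℝ) (-1) half)
      = ∫⁻ t, f t ∂(bernoulliMeasure (1 : ℝ) (-1) u) := by
  have h0 := u.2.1
  have h1 := u.2.2
  rw [lintegral_bernoulliMeasure, lintegral_bernoulliMeasure]
  have e1 : ENNReal.ofReal (half : ℝ) * likelihood u 1 = ENNReal.ofReal u := by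
    rw [likelihood, ← ENNReal.ofReal_mul half.2.1]; congr 1; simp only [half]; ring
  have e2 : ENNReal.ofReal (1 - (half : ℝ)) * likelihood u (-1) = ENNReal.ofReal (1 - u) := by
    rw [likelihood, ← ENNReal.ofReal_mul (sub_nonneg.2 half.2.2)]; congr 1; simp only [half]; ring
  rw [← e1, ← e2]
  ring

lemma lintegral_likelihood_sq (u : I) :
    ∫⁻ t, likelihood u t ^ (2 : ℝ) ∂(bernoulliMeasure (1 : ℝ) (-1) half)
      = ENNReal.ofReal (1 + (2 * (u : ℝ) - 1) ^ 2) := by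
  have h0 := u.2.1
  have h1 := u.2.2
  rw [lintegral_bernoulliMeasure]
  simp only [likelihood, ENNReal.rpow_ofNat]
  rw [← ENNReal.ofReal_pow (by linarith), ← ENNReal.ofReal_pow (by linarith),
    ← ENNReal.ofReal_mul half.2.1, ← ENNReal.ofReal_mul (sub_nonneg.2 half.2.2),
    ← ENNReal.ofReal_add]
  · congr 1; simp only [half]; ring
  · simp only [half]; positivity
  · simp only [half]; norm_num; positivity

/-- It suffices to compare rectangles, where the indicator times the density is a product over the
coordinates and independence reduces the claim to one increment. -/
lemma pi_eq_withDensity_likelihood (u : I) (n : ℕ) :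
    Measure.pi (fun _ : Fin n => bernoulliMeasure (1 : ℝ) (-1) u)
      = (Measure.pi (fun _ : Fin n => bernoulliMeasure (1 : ℝ) (-1) half)).withDensity
          fun w => ∏ i, likelihood u (w i) := by
  refine Measure.pi_eq fun s hs => ?_
  rw [withDensity_apply _ (MeasurableSet.univ_pi hs),
    ← lintegral_indicator (MeasurableSet.univ_pi hs)]
  have h1 : (Set.univ.pi s).indicator (fun w : Fin n → ℝ => ∏ i, likelihood u (w i))
      = fun w => ∏ i, (s i).indicator 1 (w i) * likelihood u (w i) := by
    classical
    funext w
    rw [Finset.prod_mul_distrib, Set.indicator_apply]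
    split_ifs with h
    · rw [Finset.prod_eq_one (f := fun i => (s i).indicator (1 : ℝ → ℝ≥0∞) (w i)), one_mul]
      intro i _
      simp [h i (Set.mem_univ i)]
    · simp only [Set.mem_univ_pi, not_forall] at h
      obtain ⟨i, hi⟩ := h
      rw [Finset.prod_eq_zero (Finset.mem_univ i) (by simp [hi]), zero_mul]
  have hm : ∀ i, Measurable fun t => (s i).indicator (1 : ℝ → ℝ≥0∞) t * likelihood u t :=
    fun i => (measurable_one.indicator (hs i)).mul (measurable_likelihood u)
  rw [h1, lintegral_prod_eq_prod_lintegral_of_indepFun Finset.univ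
    (fun i (w : Fin n → ℝ) => (s i).indicator 1 (w i) * likelihood u (w i))
    (iIndepFun_pi (X := fun i t => (s i).indicator 1 t * likelihood u t)
      (fun i => (hm i).aemeasurable))
    (fun i => (hm i).comp (measurable_pi_apply i))]
  refine Finset.prod_congr rfl fun i _ => ?_
  have h2 := (measurePreserving_eval
    (fun _ : Fin n => bernoulliMeasure (1 : ℝ) (-1) half) i).lintegral_comp (hm i)
  simp only [Function.eval] at h2
  rw [h2, lintegral_half_mul_likelihood, lintegral_indicator_one (hs i)]

lemma lintegral_prod_likelihood_sq (u : I) (n : ℕ) :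
    ∫⁻ w, (∏ i, likelihood u (w i)) ^ (2 : ℝ)
        ∂(Measure.pi (fun _ : Fin n => bernoulliMeasure (1 : ℝ) (-1) half))
      = ENNReal.ofReal (1 + (2 * (u : ℝ) - 1) ^ 2) ^ n := by
  have hm : Measurable fun t => likelihood u t ^ (2 : ℝ) := by fun_prop
  simp_rw [← ENNReal.prod_rpow_of_nonneg (zero_le_two : (0 : ℝ) ≤ 2)]
  rw [lintegral_prod_eq_prod_lintegral_of_indepFun Finset.univ
    (fun i (w : Fin n → ℝ) => likelihood u (w i) ^ (2 : ℝ))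
    (iIndepFun_pi (X := fun i t => likelihood u t ^ (2 : ℝ)) (fun i => hm.aemeasurable))
    (fun i => hm.comp (measurable_pi_apply i))]
  rw [Finset.prod_congr rfl (g := fun _ => ENNReal.ofReal (1 + (2 * (u : ℝ) - 1) ^ 2))]
  · simp
  · intro i _
    have h2 := (measurePreserving_eval
      (fun _ : Fin n => bernoulliMeasure (1 : ℝ) (-1) half) i).lintegral_comp hm
    simp only [Function.eval] at h2
    rw [h2, lintegral_likelihood_sq]

/-- An event that depends on the first `n` increments only has under drift `2 u - 1` a probability
that is bounded by its probability under drift zero and the second moment of the likelihood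
ratio. -/
theorem incrementLaw_le_of_dependsOn (u : I) (n : ℕ) {A : Set (ℕ → ℝ)} (hA : MeasurableSet A)
    (hdep : ∀ z z' : ℕ → ℝ, (∀ i < n, z i = z' i) → z ∈ A → z' ∈ A) :
    incrementLaw u A ≤ incrementLaw half A ^ (1 / 2 : ℝ)
      * (ENNReal.ofReal (1 + (2 * (u : ℝ) - 1) ^ 2) ^ n) ^ (1 / 2 : ℝ) := by
  -- Padding by zeros is harmless, as `A` ignores all coordinates from `n` on; so `A` is the
  -- preimage of a set in `Fin n → ℝ`.
  let ext : (Fin n → ℝ) → (ℕ → ℝ) := fun w i => if h : i < n then w ⟨i, h⟩ else 0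
  have hext : Measurable ext := by
    refine measurable_pi_lambda _ fun i => ?_
    by_cases h : i < n
    · simp only [ext, h, dite_true]; fun_prop
    · simp only [ext, h, dite_false]; fun_prop
  have hB : MeasurableSet (ext ⁻¹' A) := hext hA
  have hpre : (fun (z : ℕ → ℝ) (i : Fin n) => z i) ⁻¹' (ext ⁻¹' A) = A := by
    refine Set.Subset.antisymm (fun z hz => ?_) (fun z hz => ?_)
    · exact hdep _ _ (fun i hi => by simp [ext, hi]) hz
    · exact hdep _ _ (fun i hi => by simp [ext, hi]) hz
  have hlaw : ∀ v : I, incrementLaw v A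
      = Measure.pi (fun _ : Fin n => bernoulliMeasure (1 : ℝ) (-1) v) (ext ⁻¹' A) := by
    intro v
    rw [← Measure.infinitePi_eq_pi, ← Measure.map_infinitePi_infinitePi_of_inj
      (P := fun _ : ℕ => bernoulliMeasure (1 : ℝ) (-1) v) (f := fun i : Fin n => (i : ℕ))
      Fin.val_injective, Measure.map_apply (by fun_prop) hB, hpre]
    rfl
  rw [hlaw, hlaw, pi_eq_withDensity_likelihood, withDensity_apply _ hB,
    ← lintegral_indicator hB]
  have h1 : (ext ⁻¹' A).indicator (fun w : Fin n → ℝ => ∏ i, likelihood u (w i))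
      = (ext ⁻¹' A).indicator 1 * fun w => ∏ i, likelihood u (w i) := by
    funext w
    by_cases h : w ∈ ext ⁻¹' A <;> simp [h]
  rw [h1]
  have hL : Measurable fun w : Fin n → ℝ => ∏ i, likelihood u (w i) :=
    Finset.measurable_prod _ fun i _ => (measurable_likelihood u).comp (measurable_pi_apply i)
  -- Cauchy–Schwarz separates the event from the likelihood ratio.
  refine (ENNReal.lintegral_mul_le_Lp_mul_Lq _ Real.HolderConjugate.two_two
    (measurable_one.indicator hB).aemeasurable hL.aemeasurable).trans ?_
  rw [lintegral_prod_likelihood_sq]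
  gcongr
  rw [← lintegral_indicator_one hB]
  refine lintegral_mono fun w => ?_
  by_cases h : w ∈ ext ⁻¹' A <;> simp [h]

/-! ### Tests of power one under small drift -/

@[fun_prop]
lemma measurable_walk (m : ℕ) : Measurable fun z : ℕ → ℝ => walk z m := by
  unfold walk; fun_prop

lemma walk_congr {z z' : ℕ → ℝ} {n m : ℕ} (h : ∀ i < n, z i = z' i) (hm : m ≤ n) :
    walk z m = walk z' m :=
  Finset.sum_congr rfl fun i hi => h i ((Finset.mem_range.1 hi).trans_le hm)

lemma measurableSet_boundary_le (k : ℕ → ℝ) (m : ℕ) :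
    MeasurableSet {z : ℕ → ℝ | k m ≤ |walk z m|} :=
  measurableSet_le measurable_const (by fun_prop)

lemma testTime_le_iff {k z : ℕ → ℝ} {n : ℕ} :
    testTime k z ≤ n ↔ ∃ m, (1 ≤ m ∧ m ≤ n) ∧ k m ≤ |walk z m| := by
  constructor
  · intro h
    by_contra! hne
    have h1 : ((n + 1 : ℕ) : ℕ∞) ≤ testTime k z := by
      refine le_iInf₂ fun m hm => ?_
      by_contra hlt
      have hlt' : m < n + 1 := by exact_mod_cast not_le.1 hlt
      exact absurd hm.2 (not_le.2 (hne m ⟨hm.1, by omega⟩))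
    have h2 := h1.trans h
    have h3 : n + 1 ≤ n := by exact_mod_cast h2
    omega
  · rintro ⟨m, ⟨h1, h2⟩, h3⟩
    exact iInf₂_le_of_le m ⟨h1, h3⟩ (by exact_mod_cast h2)

lemma testTime_lt_top_iff {k z : ℕ → ℝ} :
    testTime k z < ⊤ ↔ ∃ m, 1 ≤ m ∧ k m ≤ |walk z m| := by
  simp only [testTime, iInf_lt_iff, ENat.natCast_lt_top, exists_prop, and_true]

lemma one_le_testTime (k z : ℕ → ℝ) : 1 ≤ testTime k z :=
  le_iInf₂ fun m hm => by exact_mod_cast hm.1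

lemma measurableSet_testTime_le (k : ℕ → ℝ) (n : ℕ) :
    MeasurableSet {z : ℕ → ℝ | testTime k z ≤ n} := by
  simp only [testTime_le_iff, Set.ofPred_exists, Set.ofPred_and]
  exact MeasurableSet.iUnion fun m => ((MeasurableSet.const _).inter
    (MeasurableSet.const _)).inter (measurableSet_boundary_le k m)

lemma measurable_testTime (k : ℕ → ℝ) : Measurable (testTime k) := by
  have h : ∀ n : ℕ, MeasurableSet {z : ℕ → ℝ | testTime k z = n} := by
    intro n
    rcases n with _ | n
    · convert MeasurableSet.empty using 1
      ext z
      simp only [Set.mem_ofPred_eq, Set.mem_empty_iff_false, iff_false]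
      intro h
      have := one_le_testTime k z
      rw [h] at this
      simp at this
    · convert (measurableSet_testTime_le k (n + 1)).diff (measurableSet_testTime_le k n) using 1
      ext z
      simp only [Set.mem_ofPred_eq, Set.mem_sdiff]
      generalize testTime k z = t
      cases t with
      | top => simpa using (ENat.natCast_ne_top (n + 1)).symm
      | coe t => norm_cast; omega
  refine measurable_to_countable' fun t => ?_
  cases t with
  | coe n => exact h n
  | top =>
    convert (MeasurableSet.iUnion h).compl using 1
    ext z
    simp only [Set.mem_preimage, Set.mem_singleton_iff, Set.mem_compl_iff, Set.mem_iUnion,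
      Set.mem_ofPred_eq, not_exists]
    generalize testTime k z = t
    cases t <;> simp

/-- Permuting finitely many increments leaves `walk z m` unchanged for large `m`, so the zero-one
law applies; the value one is excluded because a single crossing already stops the test. -/
lemma incrementLaw_half_frequently_eq_zero {k : ℕ → ℝ} {γ : ℝ} (hγ : γ < 1)
    (hk : IsPowerOneTest k γ) :
    incrementLaw half {z | ∀ M, ∃ m, M ≤ m ∧ k m ≤ |walk z m|} = 0 := by
  have hm : MeasurableSet {z : ℕ → ℝ | ∀ M, ∃ m, M ≤ m ∧ k m ≤ |walk z m|} := by
    simp only [Set.ofPred_forall, Set.ofPred_exists, Set.ofPred_and]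
    exact MeasurableSet.iInter fun M => MeasurableSet.iUnion fun m =>
      (MeasurableSet.const _).inter (measurableSet_boundary_le k m)
  have hlt : incrementLaw half {z | ∀ M, ∃ m, M ≤ m ∧ k m ≤ |walk z m|} < 1 := by
    refine ((measure_mono fun z hz => ?_).trans (hk.level half (by norm_num [half]))).trans_lt
      (ENNReal.ofReal_lt_one.2 hγ)
    exact testTime_lt_top_iff.2 (hz 1)
  refine (measure_eq_zero_or_one_of_exchangeable _ hm fun π hπ => ?_).resolve_right hlt.ne
  obtain ⟨N, hN⟩ := hπ.bddAbove
  have hw : ∀ (z : ℕ → ℝ) (m : ℕ), N < m → walk (fun i => z (π i)) m = walk z m := by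
    intro z m hm
    refine Equiv.Perm.sum_comp π _ z fun i hi => ?_
    have := hN hi
    simp only [Finset.coe_range, Set.mem_Iio]
    omega
  ext z
  simp only [Set.mem_preimage, Set.mem_ofPred_eq]
  constructor
  · intro h M
    obtain ⟨m, hm, hm'⟩ := h (max M (N + 1))
    exact ⟨m, (le_max_left _ _).trans hm, hw z m (by omega) ▸ hm'⟩
  · intro h M
    obtain ⟨m, hm, hm'⟩ := h (max M (N + 1))
    exact ⟨m, (le_max_left _ _).trans hm, (hw z m (by omega)).symm ▸ hm'⟩

lemma exists_incrementLaw_half_le {k : ℕ → ℝ} {γ : ℝ} (hγ : γ < 1) (hk : IsPowerOneTest k γ)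
    {e : ℝ≥0∞} (he : 0 < e) :
    ∃ M, incrementLaw half {z | ∃ m, M ≤ m ∧ k m ≤ |walk z m|} ≤ e := by
  have hm : ∀ M : ℕ, MeasurableSet {z : ℕ → ℝ | ∃ m, M ≤ m ∧ k m ≤ |walk z m|} := by
    intro M
    simp only [Set.ofPred_exists, Set.ofPred_and]
    exact MeasurableSet.iUnion fun m =>
      (MeasurableSet.const _).inter (measurableSet_boundary_le k m)
  have ht := tendsto_measure_iInter_atTop (μ := incrementLaw half)
    (fun M => (hm M).nullMeasurableSet)
    (fun M M' h z hz => by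
      obtain ⟨m, hm, hm'⟩ := hz
      exact ⟨m, h.trans hm, hm'⟩)
    ⟨0, measure_ne_top _ _⟩
  rw [← Set.ofPred_forall, incrementLaw_half_frequently_eq_zero hγ hk] at ht
  exact ((ht.eventually (gt_mem_nhds he)).exists).imp fun M h => h.le

lemma incrementLaw_le_ofReal (u : I) (n : ℕ) {A : Set (ℕ → ℝ)} (hA : MeasurableSet A)
    (hdep : ∀ z z' : ℕ → ℝ, (∀ i < n, z i = z' i) → z ∈ A → z' ∈ A) {a b : ℝ} (ha : 0 ≤ a)
    (hb : 0 ≤ b) (h0 : incrementLaw half A ≤ ENNReal.ofReal a)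
    (hab : a * (1 + (2 * (u : ℝ) - 1) ^ 2) ^ n ≤ b ^ 2) :
    incrementLaw u A ≤ ENNReal.ofReal b := by
  calc incrementLaw u A ≤ incrementLaw half A ^ (1 / 2 : ℝ)
        * (ENNReal.ofReal (1 + (2 * (u : ℝ) - 1) ^ 2) ^ n) ^ (1 / 2 : ℝ) :=
        incrementLaw_le_of_dependsOn u n hA hdep
    _ ≤ ENNReal.ofReal a ^ (1 / 2 : ℝ)
        * (ENNReal.ofReal (1 + (2 * (u : ℝ) - 1) ^ 2) ^ n) ^ (1 / 2 : ℝ) := by gcongr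
    _ = ENNReal.ofReal (a * (1 + (2 * (u : ℝ) - 1) ^ 2) ^ n) ^ (1 / 2 : ℝ) := by
        rw [← ENNReal.mul_rpow_of_nonneg _ _ (by norm_num), ← ENNReal.ofReal_pow (by positivity),
          ← ENNReal.ofReal_mul ha]
    _ ≤ ENNReal.ofReal (b ^ 2) ^ (1 / 2 : ℝ) := by gcongr
    _ = ENNReal.ofReal b := by
        rw [ENNReal.ofReal_rpow_of_nonneg (by positivity) (by norm_num), ← Real.sqrt_eq_rpow,
          Real.sqrt_sq hb]

/-- For small drift `θ` a test of power one runs longer than `K / θ ^ 2` with a probability that is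
bounded away from zero, uniformly in `K`. -/
theorem exists_incrementLaw_testTime_le {k : ℕ → ℝ} {γ : ℝ} (hγ : γ ∈ Set.Ioo (0 : ℝ) 1)
    (hk : IsPowerOneTest k γ) :
    ∃ q : ℝ, 0 < q ∧ q < 1 ∧ ∀ K : ℝ, ∃ θ₀ > (0 : ℝ), ∀ u : I, |2 * (u : ℝ) - 1| < θ₀ →
      ∀ n : ℕ, n * (2 * (u : ℝ) - 1) ^ 2 ≤ K →
        incrementLaw u {z | testTime k z ≤ n} ≤ ENNReal.ofReal q := by
  obtain ⟨hγ0, hγ1⟩ := hγ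
  set r := Real.sqrt γ
  have hr0 : 0 < r := Real.sqrt_pos.2 hγ0
  have hr1 : r < 1 := by rw [Real.sqrt_lt' one_pos]; simpa using hγ1
  have hrγ : r ^ 2 = γ := Real.sq_sqrt hγ0.le
  -- The bound is the sum of `(3 r + 1) / 4` for stopping by time `M` and `(1 - r) / 4` for a later
  -- crossing; `a` is chosen so that `a * exp K = ((1 - r) / 4) ^ 2`.
  refine ⟨(1 + r) / 2, by linarith, by linarith, fun K => ?_⟩
  set a := ((1 - r) / 4) ^ 2 / Real.exp K with ha
  have ha0 : 0 < a := div_pos (pow_pos (by linarith) 2) (Real.exp_pos K)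
  obtain ⟨M, hM⟩ := exists_incrementLaw_half_le hγ1 hk (ENNReal.ofReal_pos.2 ha0)
  -- `M` is fixed before `θ₀`: at zero drift the Cauchy–Schwarz bound for stopping by `M` is `√γ = r
  -- < (3 r + 1) / 4`, and this persists for small `θ`.
  have hcont : ContinuousAt (fun θ : ℝ => γ * (1 + θ ^ 2) ^ M) 0 := by fun_prop
  have hlt : γ * (1 + (0 : ℝ) ^ 2) ^ M < ((3 * r + 1) / 4) ^ 2 := by
    simp only [ne_eq, OfNat.ofNat_ne_zero, not_false_eq_true, zero_pow, add_zero, one_pow, mul_one]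
    rw [← hrγ]
    exact pow_lt_pow_left₀ (by linarith) hr0.le two_ne_zero
  obtain ⟨θ₀, hθ₀, hθ⟩ := Metric.eventually_nhds_iff.1 (hcont.eventually (gt_mem_nhds hlt))
  refine ⟨θ₀, hθ₀, fun u hu n hn => ?_⟩
  have hsub : {z | testTime k z ≤ n} ⊆ {z | testTime k z ≤ M}
      ∪ {z | ∃ m, (M ≤ m ∧ m ≤ n) ∧ k m ≤ |walk z m|} := by
    intro z hz
    obtain ⟨m, ⟨h1, h2⟩, h3⟩ := testTime_le_iff.1 hz
    rcases le_total m M with h | h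
    · exact Or.inl (testTime_le_iff.2 ⟨m, ⟨h1, h⟩, h3⟩)
    · exact Or.inr ⟨m, ⟨h, h2⟩, h3⟩
  have hA : incrementLaw u {z | testTime k z ≤ M} ≤ ENNReal.ofReal ((3 * r + 1) / 4) := by
    refine incrementLaw_le_ofReal u M (measurableSet_testTime_le k M) ?_ hγ0.le (by linarith)
      ((measure_mono fun z hz => ?_).trans (hk.level half (by norm_num [half])))
      (hθ (by simpa [Real.dist_eq] using hu)).le
    · intro z z' h hz
      obtain ⟨m, h1, h2⟩ := testTime_le_iff.1 hz
      exact testTime_le_iff.2 ⟨m, h1, walk_congr h h1.2 ▸ h2⟩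
    · have hz' : testTime k z ≤ M := hz
      exact hz'.trans_lt (ENat.natCast_lt_top M)
  have hB : incrementLaw u {z | ∃ m, (M ≤ m ∧ m ≤ n) ∧ k m ≤ |walk z m|}
      ≤ ENNReal.ofReal ((1 - r) / 4) := by
    refine incrementLaw_le_ofReal u n ?_ ?_ ha0.le (by linarith)
      ((measure_mono fun z hz => ?_).trans hM) ?_
    · simp only [Set.ofPred_exists, Set.ofPred_and]
      exact MeasurableSet.iUnion fun m => ((MeasurableSet.const _).inter
        (MeasurableSet.const _)).inter (measurableSet_boundary_le k m)
    · rintro z z' h ⟨m, h1, h2⟩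
      exact ⟨m, h1, walk_congr h h1.2 ▸ h2⟩
    · obtain ⟨m, h1, h2⟩ := hz
      exact ⟨m, h1.1, h2⟩
    · have h1 : (1 + (2 * (u : ℝ) - 1) ^ 2) ^ n ≤ Real.exp K := by
        calc (1 + (2 * (u : ℝ) - 1) ^ 2) ^ n ≤ Real.exp ((2 * (u : ℝ) - 1) ^ 2) ^ n := by
              gcongr
              linarith [Real.add_one_le_exp ((2 * (u : ℝ) - 1) ^ 2)]
          _ = Real.exp (n * (2 * (u : ℝ) - 1) ^ 2) := (Real.exp_nat_mul _ _).symm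
          _ ≤ Real.exp K := Real.exp_le_exp.2 hn
      calc a * (1 + (2 * (u : ℝ) - 1) ^ 2) ^ n ≤ a * Real.exp K := by gcongr
        _ = ((1 - r) / 4) ^ 2 := div_mul_cancel₀ _ (Real.exp_pos K).ne'
  calc incrementLaw u {z | testTime k z ≤ n}
      ≤ incrementLaw u {z | testTime k z ≤ M}
        + incrementLaw u {z | ∃ m, (M ≤ m ∧ m ≤ n) ∧ k m ≤ |walk z m|} :=
        (measure_mono hsub).trans (measure_union_le _ _)
    _ ≤ ENNReal.ofReal ((3 * r + 1) / 4) + ENNReal.ofReal ((1 - r) / 4) := add_le_add hA hB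
    _ = ENNReal.ofReal ((1 + r) / 2) := by
        rw [← ENNReal.ofReal_add (by linarith) (by linarith)]; congr 1; ring

/-! ### The law of the observed signs -/

@[fun_prop]
lemma measurable_obsSign : Measurable obsSign :=
  Measurable.ite measurableSet_Ici measurable_const measurable_const

lemma obsSign_eq_neg_one_iff {y : ℝ} : obsSign y = -1 ↔ ¬ obsSign y = 1 := by
  unfold obsSign
  split_ifs <;> norm_num

lemma eq_bernoulliMeasure_of_real_eq {α : Type*} [MeasurableSpace α] (ρ : Measure α)
    [IsProbabilityMeasure ρ] {h : α → ℝ} (hm : Measurable h) (hh : ∀ t, h t = -1 ↔ ¬ h t = 1)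
    (u : I) (hu : (u : ℝ) = ρ.real {t | h t = 1}) :
    ρ.map h = bernoulliMeasure (1 : ℝ) (-1) u := by
  classical
  have hms : MeasurableSet {t | h t = 1} := hm (measurableSet_singleton 1)
  have h1 : ((toNNReal u : NNReal) : ℝ≥0∞) = ρ {t | h t = 1} := by
    rw [← ENNReal.ofReal_coe_nnreal, coe_toNNReal, hu, ofReal_measureReal]
  have h2 : ((toNNReal (σ u) : NNReal) : ℝ≥0∞) = ρ {t | h t = 1}ᶜ := by
    rw [← ENNReal.ofReal_coe_nnreal, coe_toNNReal, coe_symm_eq, hu, ← probReal_compl_eq_one_sub hms,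
      ofReal_measureReal]
  have hcase : ∀ t, h t = 1 ∨ h t = -1 := fun t => by rw [hh]; exact em _
  ext s hs
  rw [Measure.map_apply hm hs, bernoulliMeasure_apply u hs, h1, h2]
  split_ifs with ha hb hb
  · convert measure_univ (μ := ρ) using 2
    ext t
    rcases hcase t with h | h <;> simp [h, ha, hb]
  · congr 1
    ext t
    rcases hcase t with h | h <;> norm_num [h, ha, hb]
  · congr 1
    ext t
    rcases hcase t with h | h <;> norm_num [h, ha, hb]
  · convert measure_empty (μ := ρ) using 2
    ext t
    rcases hcase t with h | h <;> simp [h, ha, hb]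

/-! ### The decision of the test, bounds on the clock, the two possible updates. -/

lemma measurableSet_testSignal_eq_one (k : ℕ → ℝ) :
    MeasurableSet {z : ℕ → ℝ | testSignal k z = 1} := by
  have h : {z : ℕ → ℝ | testSignal k z = 1}
      = ⋃ m : ℕ, {z | (testTime k z).toNat = m} ∩ {z | 0 < walk z m} := by
    ext z
    simp only [testSignal, Set.mem_ofPred_eq, Set.mem_iUnion, Set.mem_inter_iff]
    constructor
    · intro h
      refine ⟨_, rfl, ?_⟩
      by_contra hne
      rw [if_neg hne] at h
      norm_num at h
    · rintro ⟨m, rfl, h⟩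
      exact if_pos h
  rw [h]
  refine MeasurableSet.iUnion fun m => MeasurableSet.inter ?_
    (measurableSet_lt measurable_const (measurable_walk m))
  exact ((measurable_of_countable ENat.toNat).comp (measurable_testTime k))
    (measurableSet_singleton m)

lemma runlength_le_wallClock (g : I → ℝ) (k : ℕ → ℝ) (p : ℝ) (f₀ : I → ℝ)
    (e : ℕ → ℕ → I → ℝ) (n : ℕ) :
    runlength g k p f₀ e n ≤ wallClock g k p f₀ e n :=
  Finset.single_le_sum (f := fun i => runlength g k p f₀ e i) (fun _ _ => zero_le)
    (Finset.mem_range.2 n.lt_succ_self)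

lemma add_one_le_wallClock (g : I → ℝ) (k : ℕ → ℝ) (p : ℝ) (f₀ : I → ℝ)
    (e : ℕ → ℕ → I → ℝ) (n : ℕ) :
    ((n + 1 : ℕ) : ℕ∞) ≤ wallClock g k p f₀ e n := by
  have h := Finset.card_nsmul_le_sum (Finset.range (n + 1)) (fun i => runlength g k p f₀ e i) 1
    fun i _ => one_le_testTime k _
  simpa [wallClock] using h

/-- Each step has only two outcomes, so `f_n` and `X_n` take finitely many values. -/
lemma update_eq_ite (p : ℝ) (f : I → ℝ) (x : I) (Z : ℝ) :
    update p f x Z = if Z = 1 then update p f x 1 else update p f x 0 := by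
  split_ifs with h
  · rw [h]
  · funext y
    simp [update, h]

/-! ### Random variables evaluated at a point with finitely many values -/

/-- Noise is measurable for each fixed `x` but not jointly in `x`; finiteness of the range of `X`
makes up for this. -/
lemma measurable_of_fiberwise {Ω ι β : Type*} [MeasurableSpace Ω] [MeasurableSpace β] {X : Ω → ι} {D : Finset ι}
    (hD : ∀ ω, X ω ∈ D) (hX : ∀ x, MeasurableSet {ω | X ω = x}) {h : ι → Ω → β}
    (hh : ∀ x, Measurable (h x)) : Measurable fun ω => h (X ω) ω := by
  intro s hs
  have hset : (fun ω => h (X ω) ω) ⁻¹' s = ⋃ x ∈ D, {ω | X ω = x} ∩ h x ⁻¹' s := by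
    ext ω
    simp only [Set.mem_preimage, Set.mem_iUnion, Set.mem_inter_iff, Set.mem_ofPred_eq, exists_prop]
    constructor
    · intro hω
      exact ⟨_, hD ω, rfl, hω⟩
    · rintro ⟨x, -, rfl, hω⟩
      exact hω
  rw [hset]
  exact Finset.measurableSet_biUnion _ fun x _ => (hX x).inter (hh x hs)

/-- Each value `x` in `J` contributes `P (X = x) * P (E x) ≤ c * P (X = x)`, and these events are
disjoint. -/
lemma measure_le_of_indep {Ω ι : Type*} {F G mΩ : MeasurableSpace Ω} {P : Measure Ω}
    [IsZeroOrProbabilityMeasure P] (hF : F ≤ mΩ) (hFG : Indep F G P) {X : Ω → ι} {D : Finset ι}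
    (hD : ∀ ω, X ω ∈ D) (hX : ∀ x, MeasurableSet[F] {ω | X ω = x}) {E : ι → Set Ω}
    (hE : ∀ x, MeasurableSet[G] (E x)) {J : Set ι} {c : ℝ≥0∞} (hc : ∀ x ∈ J, P (E x) ≤ c) :
    P {ω | X ω ∈ J ∧ ω ∈ E (X ω)} ≤ c := by
  classical
  have hsub : {ω | X ω ∈ J ∧ ω ∈ E (X ω)}
      ⊆ ⋃ x ∈ D.filter (· ∈ J), {ω | X ω = x} ∩ E x := by
    rintro ω ⟨h1, h2⟩
    simp only [Set.mem_iUnion, Finset.mem_filter, exists_prop]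
    exact ⟨_, ⟨hD ω, h1⟩, rfl, h2⟩
  calc P {ω | X ω ∈ J ∧ ω ∈ E (X ω)}
      ≤ ∑ x ∈ D.filter (· ∈ J), P ({ω | X ω = x} ∩ E x) :=
        (measure_mono hsub).trans (measure_biUnion_finset_le _ _)
    _ ≤ ∑ x ∈ D.filter (· ∈ J), P {ω | X ω = x} * c := by
        refine Finset.sum_le_sum fun x hx => ?_
        rw [(Indep_iff F G P).1 hFG _ _ (hX x) (hE x)]
        gcongr
        exact hc x (Finset.mem_filter.1 hx).2
    _ = P (⋃ x ∈ D.filter (· ∈ J), {ω | X ω = x}) * c := by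
        rw [← Finset.sum_mul, measure_biUnion_finset _ fun x _ => hF _ (hX x)]
        intro x _ y _ hxy
        exact Set.disjoint_left.2 fun ω h1 h2 => hxy (h1.symm.trans h2)
    _ ≤ c := mul_le_of_le_one_left' prob_le_one

/-! ### Measurability of the algorithm with respect to the noise -/

section NoiseSigma

variable {Ω : Type*} {ε : ℕ → ℕ → I → Ω → ℝ}

/-- The σ-algebra generated by the noise of the evaluations in `S`. -/
abbrev noiseSigma (ε : ℕ → ℕ → I → Ω → ℝ) (S : Set (ℕ × ℕ)) : MeasurableSpace Ω :=
  ⨆ q ∈ S, MeasurableSpace.comap (fun ω (x : I) => ε q.1 q.2 x ω) MeasurableSpace.pi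

lemma noiseSigma_mono {S T : Set (ℕ × ℕ)} (h : S ⊆ T) : noiseSigma ε S ≤ noiseSigma ε T :=
  biSup_mono h

lemma measurable_noiseSigma_obsSigns {S : Set (ℕ × ℕ)} {n : ℕ} (hS : ∀ i, (n, i) ∈ S) (g : I → ℝ)
    (x : I) : Measurable[noiseSigma ε S] fun ω => obsSigns g (fun i y => ε n i y ω) x := by
  refine @measurable_pi_lambda _ _ _ (noiseSigma ε S) _ _ fun i => ?_
  have h1 : Measurable[noiseSigma ε S] fun ω (y : I) => ε n i y ω :=
    Measurable.mono (comap_measurable _)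
      (le_iSup₂ (f := fun (q : ℕ × ℕ) (_ : q ∈ S) =>
        MeasurableSpace.comap (fun ω (x : I) => ε q.1 q.2 x ω) MeasurableSpace.pi) (n, i) (hS i))
      le_rfl
  have h2 : Measurable fun w : I → ℝ => obsSign (g x + w x) := by fun_prop
  exact h2.comp h1

variable (g : I → ℝ) (k : ℕ → ℝ) (p : ℝ) (f₀ : I → ℝ)

/-- The density `f_n` takes finitely many values and depends only on the noise of the first `n`
macro replications. -/
lemma density_finite_measurable (n : ℕ) :
    (∃ D : Finset (I → ℝ), ∀ ω, density g k p f₀ (fun n i x => ε n i x ω) n ∈ D) ∧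
    ∀ f, MeasurableSet[noiseSigma ε {q | q.1 < n}]
      {ω | density g k p f₀ (fun n i x => ε n i x ω) n = f} := by
  classical
  induction n with
  | zero =>
    refine ⟨⟨{f₀}, fun ω => by simp [density]⟩, fun f => ?_⟩
    simp only [density]
    exact @MeasurableSet.const _ (noiseSigma ε {q | q.1 < 0}) _
  | succ n ih =>
    obtain ⟨⟨D, hD⟩, hf⟩ := ih
    have hstep : ∀ ω, density g k p f₀ (fun n i x => ε n i x ω) (n + 1)
        = update p (density g k p f₀ (fun n i x => ε n i x ω) n)
          (median (density g k p f₀ (fun n i x => ε n i x ω) n))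
          (testSignal k (obsSigns g (fun i x => ε n i x ω)
            (median (density g k p f₀ (fun n i x => ε n i x ω) n)))) := fun ω => rfl
    constructor
    · refine ⟨D.image (fun f => update p f (median f) 1)
        ∪ D.image (fun f => update p f (median f) 0), fun ω => ?_⟩
      rw [hstep, update_eq_ite, Finset.mem_union]
      split_ifs
      · exact Or.inl (Finset.mem_image_of_mem _ (hD ω))
      · exact Or.inr (Finset.mem_image_of_mem _ (hD ω))
    · intro f
      have hset : {ω | density g k p f₀ (fun n i x => ε n i x ω) (n + 1) = f}
          = ⋃ f' ∈ D, {ω | density g k p f₀ (fun n i x => ε n i x ω) n = f'} ∩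
            (fun ω => obsSigns g (fun i x => ε n i x ω) (median f')) ⁻¹'
              {z | update p f' (median f') (testSignal k z) = f} := by
        ext ω
        simp only [Set.mem_ofPred_eq, Set.mem_iUnion, Set.mem_inter_iff, Set.mem_preimage,
          hstep ω, exists_prop]
        constructor
        · intro h
          exact ⟨_, hD ω, rfl, h⟩
        · rintro ⟨f', -, h1, h2⟩
          rw [h1]
          exact h2
      rw [hset]
      refine Finset.measurableSet_biUnion _ fun f' _ => ?_
      refine @MeasurableSet.inter _ (noiseSigma ε {q | q.1 < n + 1}) _ _ ?_ ?_
      · exact noiseSigma_mono (fun q (hq : q.1 < n) => Nat.lt_succ_of_lt hq) _ (hf f')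
      · refine measurable_noiseSigma_obsSigns (fun i => Nat.lt_succ_self n) g _ ?_
        simp_rw [update_eq_ite p f' (median f') (testSignal k _)]
        have h1 : {z : ℕ → ℝ | (if testSignal k z = 1 then update p f' (median f') 1
              else update p f' (median f') 0) = f}
            = Set.ite {z | testSignal k z = 1} {_z | update p f' (median f') 1 = f}
              {_z | update p f' (median f') 0 = f} := by
          ext z
          by_cases h : testSignal k z = 1 <;> simp [Set.ite, h]
        rw [h1]
        exact (measurableSet_testSignal_eq_one k).ite (MeasurableSet.const _)
          (MeasurableSet.const _)

lemma point_finite_measurable (n : ℕ) :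
    (∃ D : Finset I, ∀ ω, point g k p f₀ (fun n i x => ε n i x ω) n ∈ D) ∧
    ∀ x, MeasurableSet[noiseSigma ε {q | q.1 < n}]
      {ω | point g k p f₀ (fun n i x => ε n i x ω) n = x} := by
  classical
  obtain ⟨⟨D, hD⟩, hf⟩ := density_finite_measurable (ε := ε) g k p f₀ n
  refine ⟨⟨D.image median, fun ω => Finset.mem_image_of_mem _ (hD ω)⟩, fun x => ?_⟩
  have hset : {ω | point g k p f₀ (fun n i x => ε n i x ω) n = x}
      = ⋃ f ∈ D.filter (fun f => median f = x),
        {ω | density g k p f₀ (fun n i x => ε n i x ω) n = f} := by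
    ext ω
    simp only [Set.mem_ofPred_eq, Set.mem_iUnion, exists_prop, Finset.mem_filter]
    constructor
    · intro h
      exact ⟨_, ⟨hD ω, h⟩, rfl⟩
    · rintro ⟨f, ⟨-, h1⟩, h2⟩
      rw [point, h2, h1]
  rw [hset]
  exact Finset.measurableSet_biUnion _ fun f _ => hf f

end NoiseSigma

/-! ### The signs as Bernoulli increments, and independence of the macro replications. -/

section Noise

variable {Ω : Type*} [MeasurableSpace Ω] {P : Measure Ω} {ν : I → Measure ℝ}
  {ε : ℕ → ℕ → I → Ω → ℝ}

/-- Here `u` is the probability of the sign `+1`. To the right of `xs` the correct sign is `-1`,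
which reverses the drift; hence the absolute values. -/
lemma exists_map_obsSigns_eq [IsProbabilityMeasure P] (hε : IsNoise P ν ε) (g : I → ℝ) (xs x : I) :
    ∃ u : I, |2 * (u : ℝ) - 1| = |2 * correctProb g ν xs x - 1| ∧
      ∀ n, P.map (fun ω => obsSigns g (fun i y => ε n i y ω) x) = incrementLaw u := by
  have hν : IsProbabilityMeasure (ν x) := by
    rw [← hε.law 0 0 x]
    exact Measure.isProbabilityMeasure_map (hε.measurable 0 0 x).aemeasurable
  have hm : Measurable fun t => obsSign (g x + t) := by fun_prop
  refine ⟨⟨(ν x).real {t | obsSign (g x + t) = 1}, measureReal_nonneg, measureReal_le_one⟩,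
    ?_, fun n => ?_⟩
  · simp only [correctProb]
    split_ifs
    · rfl
    · have h1 : {t | obsSign (g x + t) = -1} = {t | obsSign (g x + t) = 1}ᶜ := by
        ext t; exact obsSign_eq_neg_one_iff
      have h2 : MeasurableSet {t | obsSign (g x + t) = 1} := hm (measurableSet_singleton 1)
      rw [h1, probReal_compl_eq_one_sub h2, abs_sub_comm]
      congr 1
      ring
  · have hind : iIndepFun (fun i ω => obsSign (g x + ε n i x ω)) P := by
      have h1 := hε.indep.precomp (g := fun i : ℕ => (n, i)) (fun i j h => (Prod.mk.inj h).2)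
      exact h1.comp (fun _ w => obsSign (g x + w x)) (fun _ => by fun_prop)
    have h2 := hind.map_fun_eq_infinitePi_map (fun i => hm.comp (hε.measurable n i x))
    refine h2.trans ?_
    unfold incrementLaw
    congr 1
    funext i
    have h3 := Measure.map_map (μ := P) hm (hε.measurable n i x)
    rw [hε.law] at h3
    refine h3.symm.trans ?_
    exact eq_bernoulliMeasure_of_real_eq _ hm (fun t => obsSign_eq_neg_one_iff) _ rfl

lemma IsNoise.comap_le (hε : IsNoise P ν ε) (q : ℕ × ℕ) :
    MeasurableSpace.comap (fun ω (x : I) => ε q.1 q.2 x ω) MeasurableSpace.pi ≤ ‹_› :=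
  (measurable_pi_lambda _ fun x => hε.measurable q.1 q.2 x).comap_le

lemma noiseSigma_le (hε : IsNoise P ν ε) (S : Set (ℕ × ℕ)) : noiseSigma ε S ≤ ‹_› :=
  iSup₂_le fun q _ => hε.comap_le q

lemma indep_noiseSigma (hε : IsNoise P ν ε) {S T : Set (ℕ × ℕ)} (hST : Disjoint S T) :
    Indep (noiseSigma ε S) (noiseSigma ε T) P :=
  indep_iSup_of_disjoint hε.comap_le hε.indep.iIndep hST

variable (g : I → ℝ) (k : ℕ → ℝ) (p : ℝ) (f₀ : I → ℝ)

lemma measurable_point (hε : IsNoise P ν ε) (n : ℕ) :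
    Measurable fun ω => point g k p f₀ (fun n i x => ε n i x ω) n := by
  obtain ⟨⟨D, hD⟩, hX⟩ := point_finite_measurable (ε := ε) g k p f₀ n
  exact measurable_of_fiberwise (h := fun x _ => x) hD
    (fun x => noiseSigma_le hε _ _ (hX x)) fun x => measurable_const

lemma measurable_testTime_obsSigns (hε : IsNoise P ν ε) (n : ℕ) (x : I) :
    Measurable fun ω => testTime k (obsSigns g (fun i y => ε n i y ω) x) :=
  (measurable_testTime k).comp ((measurable_noiseSigma_obsSigns (S := Set.univ)
    (fun _ => Set.mem_univ _) g x).mono (noiseSigma_le hε _) le_rfl)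

lemma measurable_runlength (hε : IsNoise P ν ε) (n : ℕ) :
    Measurable fun ω => runlength g k p f₀ (fun n i x => ε n i x ω) n := by
  obtain ⟨⟨D, hD⟩, hX⟩ := point_finite_measurable (ε := ε) g k p f₀ n
  exact measurable_of_fiberwise
    (h := fun x ω => testTime k (obsSigns g (fun i y => ε n i y ω) x)) hD
    (fun x => noiseSigma_le hε _ _ (hX x)) fun x => measurable_testTime_obsSigns g k hε n x

lemma measurable_scaledError (hε : IsNoise P ν ε) (xs : I) (n : ℕ) :
    Measurable fun ω => scaledError g k p f₀ xs (fun n i x => ε n i x ω) n := by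
  have h1 : Measurable fun ω => wallClock g k p f₀ (fun n i x => ε n i x ω) n :=
    Finset.measurable_sum _ fun i _ => measurable_runlength g k p f₀ hε i
  have h2 : Measurable fun ω =>
      (((wallClock g k p f₀ (fun n i x => ε n i x ω) n).toNat : ℕ) : ℝ) :=
    (measurable_of_countable fun t : ℕ∞ => ((t.toNat : ℕ) : ℝ)).comp h1
  exact h2.sqrt.mul
    (((measurable_subtype_coe.comp (measurable_point g k p f₀ hε n)).sub_const _).norm)

/-- `X_n` is determined by replications before `n`, whose noise is independent of that of
replication `n`; a bound uniform over fixed points of `J` therefore holds at `X_n`. -/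
lemma measure_point_mem_inter_le [IsProbabilityMeasure P] (hε : IsNoise P ν ε) (n : ℕ) {E : I → Set (ℕ → ℝ)}
    (hE : ∀ x, MeasurableSet (E x)) {J : Set I} {c : ℝ≥0∞}
    (hc : ∀ x ∈ J, P.map (fun ω => obsSigns g (fun i y => ε n i y ω) x) (E x) ≤ c) :
    P {ω | point g k p f₀ (fun n i x => ε n i x ω) n ∈ J ∧
      obsSigns g (fun i y => ε n i y ω) (point g k p f₀ (fun n i x => ε n i x ω) n)
        ∈ E (point g k p f₀ (fun n i x => ε n i x ω) n)} ≤ c := by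
  obtain ⟨⟨D, hD⟩, hX⟩ := point_finite_measurable (ε := ε) g k p f₀ n
  have hm : ∀ x, Measurable[noiseSigma ε {q | q.1 = n}]
      fun ω => obsSigns g (fun i y => ε n i y ω) x :=
    fun x => measurable_noiseSigma_obsSigns (fun _ => rfl) g x
  refine measure_le_of_indep (noiseSigma_le hε _) (indep_noiseSigma hε ?_) hD hX
    (E := fun x => (fun ω => obsSigns g (fun i y => ε n i y ω) x) ⁻¹' E x)
    (fun x => hm x (hE x)) fun x hx => ?_
  · exact Set.disjoint_left.2 fun q (h1 : q.1 < n) (h2 : q.1 = n) => h1.ne h2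
  · rw [← Measure.map_apply ((hm x).mono (noiseSigma_le hε _) le_rfl) (hE x)]
    exact hc x hx

end Noise

/-! ### Finiteness of the clock and failure of tightness. -/

section Limit

variable {Ω : Type*} [MeasurableSpace Ω] {P : Measure Ω}
  {ν : I → Measure ℝ} {ε : ℕ → ℕ → I → Ω → ℝ} {g : I → ℝ} {k : ℕ → ℝ} {γ p : ℝ} {f₀ : I → ℝ}
  {xs : I}

/-- Away from `xs` the drift is nonzero, so never stopping has probability `0` at each such point,
and hence at `X_n`. -/
lemma ae_runlength_lt_top [IsProbabilityMeasure P] (hε : IsNoise P ν ε) (hk : IsPowerOneTest k γ)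
    (hcorrect : ∀ x, x ≠ xs → 1 / 2 < correctProb g ν xs x) (n : ℕ)
    (hne : ∀ᵐ ω ∂P, point g k p f₀ (fun n i x => ε n i x ω) n ≠ xs) :
    ∀ᵐ ω ∂P, runlength g k p f₀ (fun n i x => ε n i x ω) n < ⊤ := by
  have hm : MeasurableSet {z : ℕ → ℝ | testTime k z < ⊤} :=
    measurable_testTime k (Set.to_countable (Set.Iio ⊤)).measurableSet
  have h := measure_point_mem_inter_le g k p f₀ hε n
    (E := fun _ => {z | testTime k z < ⊤}ᶜ) (J := {x | x ≠ xs}) (c := 0) (fun _ => hm.compl)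
    fun x hx => by
      obtain ⟨u, hu, hlaw⟩ := exists_map_obsSigns_eq hε g xs x
      rw [hlaw, nonpos_iff_eq_zero, prob_compl_eq_zero_iff hm]
      refine hk.power u (abs_ne_zero.1 ?_)
      rw [hu, abs_ne_zero]
      linarith [hcorrect x hx]
  filter_upwards [hne, measure_eq_zero_iff_ae_notMem.1 (nonpos_iff_eq_zero.1 h)] with ω h1 h2
  by_contra h3
  exact h2 ⟨h1, h3⟩

lemma ae_wallClock_lt_top [IsProbabilityMeasure P] (hε : IsNoise P ν ε) (hk : IsPowerOneTest k γ)
    (hcorrect : ∀ x, x ≠ xs → 1 / 2 < correctProb g ν xs x)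
    (hne : ∀ᵐ ω ∂P, ∀ n, point g k p f₀ (fun n i x => ε n i x ω) n ≠ xs) :
    ∀ᵐ ω ∂P, ∀ n, wallClock g k p f₀ (fun n i x => ε n i x ω) n < ⊤ := by
  have h : ∀ᵐ ω ∂P, ∀ n, runlength g k p f₀ (fun n i x => ε n i x ω) n < ⊤ :=
    ae_all_iff.2 fun n => ae_runlength_lt_top hε hk hcorrect n (ae_all_iff.1 hne n)
  filter_upwards [h] with ω hω n
  exact WithTop.sum_lt_top.2 fun i _ => hω i

lemma exists_scaledError_bound_of_isTight (hε : IsNoise P ν ε)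
    (ht : IsTightMeasureSet (Set.range fun n : ℕ =>
      P.map fun ω => scaledError g k p f₀ xs (fun n i x => ε n i x ω) n))
    {e : ℝ≥0∞} (he : 0 < e) :
    ∃ R : ℝ, 0 < R ∧
      ∀ n, P {ω | R < scaledError g k p f₀ xs (fun n i x => ε n i x ω) n} ≤ e := by
  obtain ⟨K, hK, hKe⟩ := isTightMeasureSet_iff_exists_isCompact_measure_compl_le.1 ht e he
  obtain ⟨R, hR0, hR⟩ := hK.isBounded.exists_pos_norm_le
  refine ⟨R, hR0, fun n => ?_⟩
  have h := hKe _ ⟨n, rfl⟩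
  rw [Measure.map_apply (measurable_scaledError g k p f₀ hε xs n) hK.measurableSet.compl] at h
  refine (measure_mono fun ω (hω : R < _) hmem => ?_).trans h
  exact absurd ((le_abs_self _).trans (hR _ hmem)) (not_le.2 hω)

/-- If the scaled error is at most `R`, the error and the run length are small. -/
lemma abs_point_sub_le_of_scaledError_le {e : ℕ → ℕ → I → ℝ} {n : ℕ} {R : ℝ}
    (hfin : wallClock g k p f₀ e n < ⊤) (hs : scaledError g k p f₀ xs e n ≤ R)
    (hne : point g k p f₀ e n ≠ xs) :
    Real.sqrt (n + 1) * |(point g k p f₀ e n : ℝ) - xs| ≤ R ∧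
    runlength g k p f₀ e n ≤
      (⌊R ^ 2 / |(point g k p f₀ e n : ℝ) - xs| ^ 2⌋₊ : ℕ) := by
  -- Finiteness matters: `toNat` sends `⊤` to `0`, so an infinite clock would give scaled error `0`.
  obtain ⟨t, ht⟩ := ENat.ne_top_iff_exists.1 hfin.ne
  set d := |(point g k p f₀ e n : ℝ) - xs| with hd
  have hd0 : 0 < d := abs_pos.2 (sub_ne_zero.2 fun h => hne (Subtype.ext h))
  have hle : Real.sqrt t * d ≤ R := by
    rw [scaledError, ← ht] at hs
    exact hs
  constructor
  · have h1 := add_one_le_wallClock g k p f₀ e n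
    rw [← ht] at h1
    have h2 : ((n : ℝ) + 1) ≤ t := by exact_mod_cast h1
    refine le_trans ?_ hle
    gcongr
  · refine (runlength_le_wallClock g k p f₀ e n).trans ?_
    rw [← ht]
    have h1 : t ≤ ⌊R ^ 2 / d ^ 2⌋₊ := by
      refine Nat.le_floor ?_
      rw [le_div_iff₀ (by positivity), ← Real.sq_sqrt (Nat.cast_nonneg t), ← mul_pow]
      gcongr
    exact_mod_cast h1

theorem not_isTightMeasureSet_scaledError [IsProbabilityMeasure P] (hε : IsNoise P ν ε) (hγ : γ ∈ Set.Ioo (0 : ℝ) 1)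
    (hk : IsPowerOneTest k γ) (hcorrect : ∀ x, x ≠ xs → 1 / 2 < correctProb g ν xs x)
    (hne : ∀ᵐ ω ∂P, ∀ n, point g k p f₀ (fun n i x => ε n i x ω) n ≠ xs)
    {δ c : ℝ} (hδ : 0 < δ) (hc : 0 < c)
    (hnear : ∀ x : I, |(x : ℝ) - xs| < δ → |correctProb g ν xs x - 1 / 2| ≤ c * |(x : ℝ) - xs|) :
    ¬ IsTightMeasureSet (Set.range fun n : ℕ =>
      P.map fun ω => scaledError g k p f₀ xs (fun n i x => ε n i x ω) n) := by
  intro ht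
  obtain ⟨q, hq0, hq1, hq⟩ := exists_incrementLaw_testTime_le hγ hk
  -- The level `(1 - q) / 2` is chosen so that adding `q` still gives less than one.
  obtain ⟨R, hR0, hR⟩ := exists_scaledError_bound_of_isTight hε ht
    (ENNReal.ofReal_pos.2 (show 0 < (1 - q) / 2 by linarith))
  -- The constant is `(R / d) ^ 2 * (2 c d) ^ 2`, the time bound times the squared drift bound at
  -- distance `d`.
  obtain ⟨θ₀, hθ₀, hθ⟩ := hq (4 * c ^ 2 * R ^ 2)
  -- Within `r` of `xs` the linear bound is available and the drift is below `θ₀`.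
  set r := min δ (θ₀ / (2 * c))
  have hr : 0 < r := lt_min hδ (by positivity)
  obtain ⟨n, hn⟩ := exists_nat_gt ((R / r) ^ 2)
  have hclose : ∀ d : ℝ, Real.sqrt (n + 1) * d ≤ R → d < r := by
    intro d hd
    have h1 : R / r < Real.sqrt (n + 1) := Real.lt_sqrt_of_sq_lt (by linarith)
    rw [div_lt_iff₀ hr] at h1
    exact lt_of_mul_lt_mul_left (hd.trans_lt h1) (Real.sqrt_nonneg _)
  have hshort := measure_point_mem_inter_le g k p f₀ hε n
    (E := fun x => {z | testTime k z ≤ (⌊R ^ 2 / |(x : ℝ) - xs| ^ 2⌋₊ : ℕ)})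
    (J := {x | x ≠ xs ∧ |(x : ℝ) - xs| < r}) (c := ENNReal.ofReal q)
    (fun x => measurableSet_testTime_le k _) fun x ⟨hx, hxr⟩ => by
      obtain ⟨u, hu, hlaw⟩ := exists_map_obsSigns_eq hε g xs x
      have hd0 : 0 < |(x : ℝ) - xs| := abs_pos.2 (sub_ne_zero.2 fun h => hx (Subtype.ext h))
      have hdrift : |2 * (u : ℝ) - 1| ≤ 2 * c * |(x : ℝ) - xs| := by
        have h1 : 2 * correctProb g ν xs x - 1 = 2 * (correctProb g ν xs x - 1 / 2) := by ring
        rw [hu, h1, abs_mul, abs_two]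
        linarith [hnear x (hxr.trans_le (min_le_left _ _))]
      rw [hlaw]
      refine hθ u (hdrift.trans_lt ?_) _ ?_
      · have := hxr.trans_le (min_le_right _ _)
        rw [lt_div_iff₀ (by positivity)] at this
        linarith
      · calc (⌊R ^ 2 / |(x : ℝ) - xs| ^ 2⌋₊ : ℝ) * (2 * (u : ℝ) - 1) ^ 2
            ≤ R ^ 2 / |(x : ℝ) - xs| ^ 2 * (2 * c * |(x : ℝ) - xs|) ^ 2 := by
              rw [← sq_abs (2 * (u : ℝ) - 1)]
              gcongr
              exact Nat.floor_le (by positivity)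
          _ = 4 * c ^ 2 * R ^ 2 := by field_simp; ring
  -- Almost surely the scaled error exceeds `R`, or `X_n` is near `xs` and its test stops early; the
  -- probabilities of these two events add up to less than one.
  have hcover : ∀ᵐ ω ∂P, ω ∈ {ω | R < scaledError g k p f₀ xs (fun n i x => ε n i x ω) n} ∪
      {ω | point g k p f₀ (fun n i x => ε n i x ω) n ∈ {x | x ≠ xs ∧ |(x : ℝ) - xs| < r} ∧
        obsSigns g (fun i y => ε n i y ω) (point g k p f₀ (fun n i x => ε n i x ω) n) ∈
          {z | testTime k z ≤ (⌊R ^ 2 /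
            |(point g k p f₀ (fun n i x => ε n i x ω) n : ℝ) - xs| ^ 2⌋₊ : ℕ)}} := by
    filter_upwards [hne, ae_wallClock_lt_top hε hk hcorrect hne] with ω h1 h2
    by_cases h3 : R < scaledError g k p f₀ xs (fun n i x => ε n i x ω) n
    · exact Or.inl h3
    · obtain ⟨h4, h5⟩ := abs_point_sub_le_of_scaledError_le (h2 n) (not_lt.1 h3) (h1 n)
      exact Or.inr ⟨⟨h1 n, hclose _ h4⟩, h5⟩
  have hone : (1 : ℝ≥0∞) ≤ ENNReal.ofReal ((1 - q) / 2) + ENNReal.ofReal q := by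
    rw [← measure_univ (μ := P)]
    exact ((measure_mono_ae (hcover.mono fun ω h _ => h)).trans (measure_union_le _ _)).trans
      (add_le_add (hR n) hshort)
  rw [← ENNReal.ofReal_add (by linarith) hq0.le, ENNReal.one_le_ofReal] at hone
  linarith

end Limit

end PBA

end

theorem proposition2 {Ω : Type*} [MeasurableSpace Ω] (P : Measure Ω) [IsProbabilityMeasure P]
    (g : unitInterval → ℝ) (xs : unitInterval) (hg : PBA.IsRoot g xs)
    (ν : unitInterval → Measure ℝ) (ε : ℕ → ℕ → unitInterval → Ω → ℝ) (hε : PBA.IsNoise P ν ε)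
    (γ : ℝ) (hγ : γ ∈ Set.Ioo (0 : ℝ) 1) (k : ℕ → ℝ) (hk : PBA.IsPowerOneTest k γ)
    (p : ℝ) (hp : p ∈ Set.Ioo (1 / 2 : ℝ) (1 - γ / 2))
    (f₀ : unitInterval → ℝ) (hf₀ : PBA.IsPositiveDensity f₀)
    (hcorrect : ∀ x, x ≠ xs → 1 / 2 < PBA.correctProb g ν xs x)
    (hne : ∀ᵐ ω ∂P, ∀ n, PBA.point g k p f₀ (fun n i x => ε n i x ω) n ≠ xs)
    (hnear : ∃ δ > (0 : ℝ), ∃ c > (0 : ℝ), ∀ x : unitInterval,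
      (x : ℝ) ∈ Set.Ioo ((xs : ℝ) - δ) ((xs : ℝ) + δ) →
        0 ≤ PBA.correctProb g ν xs x - 1 / 2 ∧
        PBA.correctProb g ν xs x - 1 / 2 ≤ c * |(x : ℝ) - xs|) :
    (∀ᵐ ω ∂P, ∀ n, PBA.wallClock g k p f₀ (fun n i x => ε n i x ω) n < ⊤) ∧
    ¬ IsTightMeasureSet (Set.range fun n : ℕ =>
      P.map fun ω => PBA.scaledError g k p f₀ xs (fun n i x => ε n i x ω) n) := by
  refine ⟨PBA.ae_wallClock_lt_top hε hk hcorrect hne, ?_⟩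
  obtain ⟨δ, hδ, c, hc, hnear⟩ := hnear
  refine PBA.not_isTightMeasureSet_scaledError hε hγ hk hcorrect hne hδ hc fun x hx => ?_
  obtain ⟨h1, h2⟩ := hnear x (by rw [abs_lt] at hx; constructor <;> linarith)
  rwa [abs_of_nonneg h1]
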